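/- For every $h_0\in(0,1)$ there is a constant $C>0$, depending only on $h_0$, such that the following holds. Let $(g_n)_{n\ge 1}$ be any sequence in $L^\infty([0,1])$ with $0\le g_n(x)\le 2^{-n+1}$ for a.e. $x\in[0,1]$ and every $n\ge 1$. Then there exists a map $\Phi:[0,1]\to[0,1]$ which preserves Lebesgue measure (it is measurable and $|\Phi^{-1}(B)|=|B|$ for every Borel set $B\subset[0,1]$) and is a.e. injective (there is a set $F'\subset[0,1]$ with $|[0,1]\setminus F'|=0$ on which $\Phi$ is injective), such that $$\sup_{n\ge 1}\int_0^1\bigl|(g_n\circ\Phi)(\xi)-(g_n\circ\Phi)(\xi+h)\bigr|\,d\xi\;\le\;2^{-C\sqrt{\log\frac1{|h|}}}\qquad\text{for all } h\in\mathbb R \text{ with } 0<|h|\le h_0,$$ where $g_n\circ\Phi$ is extended by zero outside $[0,1]$, that is, $(g_n\circ\Phi)(\xi+h)=0$ whenever $\xi+h\notin[0,1]$. -/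

import Mathlib

open MeasureTheory

/-- The extension by zero to the whole real line of a function on `[0,1]`. -/
noncomputable def zeroExtend (u : unitInterval → ℝ) : ℝ → ℝ :=
  Function.extend (Subtype.val : unitInterval → ℝ) u 0

/-- `Φ` is a.e. injective: it is injective on a set of full Lebesgue measure. -/
def AEInjective (Φ : unitInterval → unitInterval) : Prop :=
  ∃ F : Set unitInterval, volume Fᶜ = 0 ∧ Set.InjOn Φ F

/-- The `L¹([0,1])` distance between `u` and its translate by `h`, where `u` is extended by zero
outside `[0,1]`. -/
noncomputable def translationModulus (u : unitInterval → ℝ) (h : ℝ) : ℝ :=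
  ∫ ξ in Set.Icc (0 : ℝ) 1, |zeroExtend u ξ - zeroExtend u (ξ + h)|

/-! ### Monotone rearrangement -/

theorem continuous_measureReal_Iic (μ : Measure unitInterval) [IsFiniteMeasure μ]
    [NullSingletonClass μ] : Continuous fun t => μ.real (Set.Iic t) := by
  have hrepr : (fun t => μ.real (Set.Iic t)) =
      fun t => ∫ x, (Set.Iic t).indicator (fun _ => (1 : ℝ)) x ∂μ := by
    funext t
    rw [integral_indicator measurableSet_Iic]
    simp
  rw [hrepr, continuous_iff_continuousAt]
  intro t
  refine continuousAt_of_dominated (bound := fun _ => 1) ?_ ?_ (integrable_const _) ?_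
  · exact Filter.Eventually.of_forall fun s =>
      (measurable_const.indicator measurableSet_Iic).aestronglyMeasurable
  · refine Filter.Eventually.of_forall fun s => Filter.Eventually.of_forall fun x => ?_
    by_cases hx : x ∈ Set.Iic s <;> simp [hx]
  · have hne : ∀ᵐ x ∂μ, x ≠ t := by simp [ae_iff, measure_singleton]
    filter_upwards [hne] with x hx
    rcases lt_or_gt_of_ne hx with hlt | hgt
    · refine ContinuousAt.congr (continuousAt_const (y := (1 : ℝ))) ?_
      filter_upwards [lt_mem_nhds hlt] with s hs
      simp [hs.le]
    · refine ContinuousAt.congr (continuousAt_const (y := (0 : ℝ))) ?_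
      filter_upwards [gt_mem_nhds hgt] with s hs
      simp [hs]

theorem exists_measureReal_Iic_eq (μ : Measure unitInterval) [IsFiniteMeasure μ]
    [NullSingletonClass μ] {c : ℝ} (hc : 0 ≤ c) (hc' : c ≤ μ.real Set.univ) :
    ∃ t, μ.real (Set.Iic t) = c := by
  have h0 : μ.real (Set.Iic (0 : unitInterval)) = 0 := by
    have : Set.Iic (0 : unitInterval) = {0} := Set.Iic_bot
    simp [this, measureReal_def]
  have h1 : μ.real (Set.Iic (1 : unitInterval)) = μ.real Set.univ := by
    have : Set.Iic (1 : unitInterval) = Set.univ := Set.Iic_top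
    rw [this]
  exact intermediate_value_univ 0 1 (continuous_measureReal_Iic μ) ⟨h0.le.trans hc, hc'.trans h1.ge⟩

/-- Any injective measurable function on `[0,1]` can be made monotone, off a null set, by a
measure-preserving a.e. injective change of variables. -/
theorem exists_monotone_rearrangement {F : unitInterval → ℝ} (hF : Measurable F)
    (hinj : Function.Injective F) :
    ∃ (Φ : unitInterval → unitInterval) (D : Set unitInterval), volume Dᶜ = 0 ∧ Set.InjOn Φ D ∧
      MeasurePreserving Φ volume volume ∧ MonotoneOn (F ∘ Φ) D := by
  set G : unitInterval → unitInterval := fun x => unitInterval.sigmoid (F x) with hGdef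
  have hG : Measurable G := by
    have : Measurable unitInterval.sigmoid := unitInterval.sigmoid_strictMono.monotone.measurable
    exact this.comp hF
  have hGinj : Function.Injective G := unitInterval.sigmoid_strictMono.injective.comp hinj
  have hGe : MeasurableEmbedding G := hG.measurableEmbedding hGinj
  set μ : Measure unitInterval := Measure.map G volume with hμ
  have : IsProbabilityMeasure μ := Measure.isProbabilityMeasure_map hG.aemeasurable
  have : NullSingletonClass μ := ⟨fun x => by
    rw [hμ, Measure.map_apply hG (measurableSet_singleton x)]
    exact (Set.subsingleton_singleton.preimage hGinj).measure_zero _⟩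
  choose Q hQ using fun u : unitInterval =>
    exists_measureReal_Iic_eq μ u.2.1 (u.2.2.trans (by simp))
  have hmono : StrictMono Q := by
    intro u v huv
    by_contra! hle
    have : (v : ℝ) ≤ u := by
      rw [← hQ u, ← hQ v]
      exact measureReal_mono (Set.Iic_subset_Iic.2 hle)
    exact absurd huv (not_lt.2 this)
  have hQm : Measurable Q := hmono.monotone.measurable
  have hmap : Measure.map Q volume = μ := by
    have : IsProbabilityMeasure (Measure.map Q (volume : Measure unitInterval)) :=
      Measure.isProbabilityMeasure_map hQm.aemeasurable
    refine Measure.ext_of_Iic _ _ fun x => ?_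
    rw [Measure.map_apply hQm measurableSet_Iic]
    let t : unitInterval := ⟨μ.real (Set.Iic x), measureReal_nonneg, measureReal_le_one⟩
    have ht : μ (Set.Iic x) = ENNReal.ofReal t := (ofReal_measureReal (measure_ne_top _ _)).symm
    rw [ht]
    apply le_antisymm
    · rw [← unitInterval.volume_Iic]
      refine measure_mono fun u hu => ?_
      change (u : ℝ) ≤ μ.real (Set.Iic x)
      rw [← hQ u]
      exact measureReal_mono (Set.Iic_subset_Iic.2 hu)
    · rw [← unitInterval.volume_Iio]
      refine measure_mono fun u hu => ?_
      by_contra hlt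
      have hlt' : x ≤ Q u := (not_le.1 hlt).le
      have hu' : (u : ℝ) < μ.real (Set.Iic x) := hu
      rw [← hQ u] at hu'
      exact absurd hu' (not_lt.2 (measureReal_mono (Set.Iic_subset_Iic.2 hlt')))
  obtain ⟨R, hR, hRG⟩ := hGe.exists_measurable_extend measurable_id fun _ => ⟨(0 : unitInterval)⟩
  have hRG' : ∀ x, R (G x) = x := fun x => congrFun hRG x
  have hD : ∀ u ∈ Q ⁻¹' Set.range G, G (R (Q u)) = Q u := by
    rintro u ⟨x, hx⟩
    rw [← hx, hRG']
  refine ⟨R ∘ Q, Q ⁻¹' Set.range G, ?_, ?_, ⟨hR.comp hQm, ?_⟩, ?_⟩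
  · rw [← Set.preimage_compl, ← Measure.map_apply hQm hGe.measurableSet_range.compl, hmap, hμ,
      Measure.map_apply hG hGe.measurableSet_range.compl]
    simp
  · intro u hu v hv huv
    apply hmono.injective
    rw [← hD u hu, ← hD v hv]
    exact congrArg G huv
  · rw [← Measure.map_map hR hQm, hmap, hμ, Measure.map_map hR hG, hRG, Measure.map_id]
  · intro u hu v hv huv
    have := hmono.monotone huv
    rw [← hD u hu, ← hD v hv] at this
    exact unitInterval.sigmoid_strictMono.le_iff_le.1 this

/-! ### Lexicographic codes -/

/-- The `j`-th binary digit of a nonnegative real number. -/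
noncomputable def binaryDigit (j : ℕ) (y : ℝ) : Bool := decide (⌊2 ^ j * y⌋₊ % 2 = 1)

theorem measurable_binaryDigit (j : ℕ) : Measurable (binaryDigit j) := by
  have h1 : Measurable fun y : ℝ => ⌊2 ^ j * y⌋₊ :=
    Nat.measurable_floor.comp (measurable_const.mul measurable_id)
  exact (measurable_of_countable fun k : ℕ => decide (k % 2 = 1)).comp h1

theorem floor_eq_of_binaryDigit_eq {y z : ℝ} (hy : y ∈ Set.Icc (0 : ℝ) 1)
    (hz : z ∈ Set.Icc (0 : ℝ) 1) {m : ℕ} (h : ∀ j ≤ m, binaryDigit j y = binaryDigit j z) :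
    ⌊2 ^ m * y⌋₊ = ⌊2 ^ m * z⌋₊ := by
  have hmod : ∀ j ≤ m, ⌊2 ^ j * y⌋₊ % 2 = ⌊2 ^ j * z⌋₊ % 2 := by
    intro j hj
    have h1 : (⌊2 ^ j * y⌋₊ % 2 = 1) ↔ (⌊2 ^ j * z⌋₊ % 2 = 1) := by
      simpa [binaryDigit] using h j hj
    omega
  have hhalf : ∀ (j : ℕ) (x : ℝ), ⌊2 ^ (j + 1) * x⌋₊ / 2 = ⌊2 ^ j * x⌋₊ := by
    intro j x
    have h1 := Nat.floor_div_natCast (2 ^ (j + 1) * x) 2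
    have h2 : 2 ^ (j + 1) * x / ((2 : ℕ) : ℝ) = 2 ^ j * x := by
      push_cast
      ring
    rw [← h1, h2]
  induction m with
  | zero =>
    have h1 := hmod 0 le_rfl
    simp only [pow_zero, one_mul] at h1 ⊢
    have h2 : ⌊y⌋₊ ≤ 1 := by simpa using Nat.floor_mono hy.2
    have h3 : ⌊z⌋₊ ≤ 1 := by simpa using Nat.floor_mono hz.2
    omega
  | succ m ih =>
    have h1 := ih (fun j hj => h j (by omega)) fun j hj => hmod j (by omega)
    have h2 := hmod (m + 1) le_rfl
    have h3 := hhalf m y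
    have h4 := hhalf m z
    omega

theorem abs_sub_le_of_binaryDigit_eq {y z : ℝ} (hy : y ∈ Set.Icc (0 : ℝ) 1)
    (hz : z ∈ Set.Icc (0 : ℝ) 1) {m : ℕ} (h : ∀ j ≤ m, binaryDigit j y = binaryDigit j z) :
    |y - z| ≤ (1 / 2) ^ m := by
  have hfl := floor_eq_of_binaryDigit_eq hy hz h
  have hy1 := Nat.floor_le (mul_nonneg (pow_nonneg zero_le_two m) hy.1)
  have hy2 := Nat.lt_floor_add_one (2 ^ m * y)
  have hz1 := Nat.floor_le (mul_nonneg (pow_nonneg zero_le_two m) hz.1)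
  have hz2 := Nat.lt_floor_add_one (2 ^ m * z)
  rw [hfl] at hy1 hy2
  have hpos : (0 : ℝ) < 2 ^ m := by positivity
  have habs : 2 ^ m * |y - z| ≤ 1 := by
    rw [← abs_of_pos hpos, ← abs_mul, abs_le, mul_sub]
    constructor <;> linarith
  rw [one_div, inv_pow, ← one_div, le_div_iff₀ hpos]
  linarith

theorem cantorFunction_prefix_eq {c : ℝ} (hc : 0 < c) (hc' : c < 1 / 2) {f g k : ℕ → Bool}
    (hfg : Cardinal.cantorFunction c f ≤ Cardinal.cantorFunction c g)
    (hgk : Cardinal.cantorFunction c g ≤ Cardinal.cantorFunction c k) {n : ℕ}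
    (h : ∀ i < n, f i = k i) : ∀ i < n, g i = f i := by
  intro i
  induction i using Nat.strong_induction_on with
  | _ i ih =>
    intro hi
    by_contra hne
    cases hgi : g i with
    | false =>
      have hfi : f i = true := by simpa [hgi] using hne
      exact absurd hfg (not_le.2 (Cardinal.increasing_cantorFunction hc hc'
        (fun j hj => ih j hj (hj.trans hi)) hgi hfi))
    | true =>
      have hfi : f i = false := by simpa [hgi] using hne
      refine absurd hgk (not_le.2 (Cardinal.increasing_cantorFunction hc hc'
        (fun j hj => ?_) ((h i hi).symm.trans hfi) hgi))
      rw [ih j hj (hj.trans hi), h j (hj.trans hi)]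

theorem measurable_cantorFunction_comp {α : Type*} [MeasurableSpace α] {c : ℝ} (hc : 0 ≤ c)
    (hc' : c < 1) {a : ℕ → α → Bool} (ha : ∀ i, Measurable (a i)) :
    Measurable fun x => Cardinal.cantorFunction c fun i => a i x := by
  have hterm : ∀ i, Measurable fun x => Cardinal.cantorFunctionAux c (fun i => a i x) i := fun i =>
    (measurable_of_countable fun b : Bool => cond b (c ^ i) 0).comp (ha i)
  exact measurable_of_tendsto_metrizable
    (fun n => Finset.measurable_sum (Finset.range n) fun i _ => hterm i)
    (tendsto_pi_nhds.2 fun x =>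
      (Cardinal.summable_cantor_function _ hc hc').hasSum.tendsto_sum_nat)

/-- The code of a point: membership in `S₂`, non-membership in `S₁`, then all binary digits of the
values of the functions `G n`. -/
noncomputable def lexCode {α : Type*} (G : ℕ → α → ℝ) (S₁ S₂ : Set α) : ℕ → α → Bool
  | 0, x => by classical exact decide (x ∈ S₂)
  | 1, x => by classical exact decide (x ∉ S₁)
  | i + 2, x => binaryDigit (Nat.unpair i).2 (G (Nat.unpair i).1 x)

section lexCode

variable {α : Type*} {G : ℕ → α → ℝ} {S₁ S₂ : Set α}

theorem lexCode_zero (x : α) : lexCode G S₁ S₂ 0 x = true ↔ x ∈ S₂ := by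
  simp [lexCode]

theorem lexCode_one (x : α) : lexCode G S₁ S₂ 1 x = true ↔ x ∉ S₁ := by
  simp [lexCode]

theorem measurable_lexCode [MeasurableSpace α] (hG : ∀ n, Measurable (G n))
    (h₁ : MeasurableSet S₁) (h₂ : MeasurableSet S₂) (i : ℕ) : Measurable (lexCode G S₁ S₂ i) := by
  match i with
  | 0 =>
    refine measurable_to_bool ?_
    convert h₂ using 1
    ext x
    simp [lexCode]
  | 1 =>
    refine measurable_to_bool ?_
    convert h₁.compl using 1
    ext x
    simp [lexCode]
  | i + 2 => exact (measurable_binaryDigit _).comp (hG _)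

theorem abs_sub_le_of_lexCode_eq (hG : ∀ n x, G n x ∈ Set.Icc (0 : ℝ) 1) {m n : ℕ} (hn : n ≤ m)
    {x y : α} (h : ∀ i < (m + 1) ^ 2 + 2, lexCode G S₁ S₂ i x = lexCode G S₁ S₂ i y) :
    |G n x - G n y| ≤ (1 / 2) ^ m := by
  refine abs_sub_le_of_binaryDigit_eq (hG n x) (hG n y) fun j hj => ?_
  have hlt : Nat.pair n j < (m + 1) ^ 2 :=
    (Nat.pair_lt_max_add_one_sq n j).trans_le (Nat.pow_le_pow_left (by omega) 2)
  simpa [lexCode] using h (Nat.pair n j + 2) (by omega)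

end lexCode

/-- Simultaneous rearrangement: the sets on which the first `m` functions are determined up to
`2⁻ᵐ` become intervals off a null set, while `S₁` and `S₂` become an initial and a final
interval. -/
theorem exists_lexicographic_rearrangement {G : ℕ → unitInterval → ℝ}
    (hGm : ∀ n, Measurable (G n)) (hG : ∀ n x, G n x ∈ Set.Icc (0 : ℝ) 1) (hG0 : ∀ x, G 0 x = x)
    {S₁ S₂ : Set unitInterval} (h₁ : MeasurableSet S₁) (h₂ : MeasurableSet S₂)
    (hd : Disjoint S₁ S₂) :
    ∃ (Φ : unitInterval → unitInterval) (D : Set unitInterval), volume Dᶜ = 0 ∧ Set.InjOn Φ D ∧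
      MeasurePreserving Φ volume volume ∧
      (∀ m, ∃ c : unitInterval → Fin ((m + 1) ^ 2 + 2) → Bool,
        (∀ x y, c x = c y → ∀ n ≤ m, |G n x - G n y| ≤ (1 / 2) ^ m) ∧
        ∀ u ∈ D, ∀ v ∈ D, ∀ w ∈ D, u ≤ v → v ≤ w → c (Φ u) = c (Φ w) → c (Φ v) = c (Φ u)) ∧
      (∀ u ∈ D, ∀ v ∈ D, u ≤ v → Φ v ∈ S₁ → Φ u ∈ S₁) ∧
      (∀ u ∈ D, ∀ v ∈ D, u ≤ v → Φ u ∈ S₂ → Φ v ∈ S₂) := by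
  have hc : (0 : ℝ) < 1 / 3 := by norm_num
  have hc' : (1 / 3 : ℝ) < 1 / 2 := by norm_num
  set a := lexCode G S₁ S₂ with ha
  set F : unitInterval → ℝ := fun x => Cardinal.cantorFunction (1 / 3) fun i => a i x with hF
  have hFm : Measurable F := measurable_cantorFunction_comp hc.le (by norm_num)
    (measurable_lexCode hGm h₁ h₂)
  have hFinj : Function.Injective F := by
    intro x y hxy
    have hcode := congrFun (Cardinal.cantorFunction_injective hc hc' hxy)
    have hle : ∀ m : ℕ, |(x : ℝ) - y| ≤ (1 / 2) ^ m := fun m => by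
      simpa [hG0] using abs_sub_le_of_lexCode_eq hG (Nat.zero_le m) fun i _ => hcode i
    have h0 : |(x : ℝ) - y| ≤ 0 := ge_of_tendsto'
      (tendsto_pow_atTop_nhds_zero_of_lt_one (by norm_num) (by norm_num)) hle
    exact Subtype.ext (sub_eq_zero.1 (abs_nonpos_iff.1 h0))
  obtain ⟨Φ, D, hD, hinj, hmp, hmono⟩ := exists_monotone_rearrangement hFm hFinj
  refine ⟨Φ, D, hD, hinj, hmp, fun m => ⟨fun x i => a i x, ?_, ?_⟩, ?_, ?_⟩
  · intro x y hxy n hn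
    exact abs_sub_le_of_lexCode_eq hG hn fun i hi => congrFun hxy ⟨i, hi⟩
  · intro u hu v hv w hw huv hvw huw
    have := cantorFunction_prefix_eq hc hc' (hmono hu hv huv) (hmono hv hw hvw)
      (fun i hi => congrFun huw ⟨i, hi⟩)
    funext i
    exact this i i.2
  · intro u hu v hv huv hS
    by_contra hu1
    have hv0 : a 0 (Φ v) = false := by
      rw [← Bool.not_eq_true, ha, lexCode_zero]
      exact Set.disjoint_left.1 hd hS
    have hv1 : a 1 (Φ v) = false := by
      rw [← Bool.not_eq_true, ha, lexCode_one]
      exact not_not.2 hS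
    have hu1' : a 1 (Φ u) = true := (lexCode_one _).2 hu1
    refine absurd (hmono hu hv huv) (not_le.2 ?_)
    cases hu0 : a 0 (Φ u) with
    | false =>
      refine Cardinal.increasing_cantorFunction hc hc' (n := 1) (fun k hk => ?_) hv1 hu1'
      obtain rfl : k = 0 := by omega
      rw [hv0, hu0]
    | true =>
      exact Cardinal.increasing_cantorFunction hc hc' (n := 0) (fun k hk => by omega) hv0 hu0
  · intro u hu v hv huv hS
    by_contra hv0
    have hv0' : a 0 (Φ v) = false := by
      rw [← Bool.not_eq_true, ha, lexCode_zero]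
      exact hv0
    exact absurd (hmono hu hv huv) (not_le.2 (Cardinal.increasing_cantorFunction hc hc' (n := 0)
      (fun k hk => by omega) hv0' ((lexCode_zero _).2 hS)))

/-! ### Estimates for the translation modulus -/

theorem zeroExtend_coe (u : unitInterval → ℝ) (x : unitInterval) : zeroExtend u x = u x :=
  Subtype.val_injective.extend_apply _ _ _

theorem zeroExtend_of_notMem (u : unitInterval → ℝ) {ξ : ℝ} (h : ξ ∉ Set.Icc (0 : ℝ) 1) :
    zeroExtend u ξ = 0 :=
  Function.extend_apply' _ _ _ (by rintro ⟨x, rfl⟩; exact h x.2)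

theorem zeroExtend_mem_Icc {u : unitInterval → ℝ} {b : ℝ} (hb : 0 ≤ b)
    (hu : ∀ x, u x ∈ Set.Icc 0 b) (ξ : ℝ) : zeroExtend u ξ ∈ Set.Icc 0 b := by
  by_cases h : ξ ∈ Set.Icc (0 : ℝ) 1
  · exact (zeroExtend_coe u ⟨ξ, h⟩).symm ▸ hu _
  · rw [zeroExtend_of_notMem u h]
    exact ⟨le_rfl, hb⟩

theorem abs_zeroExtend_sub_le {u : unitInterval → ℝ} {b : ℝ} (hb : 0 ≤ b)
    (hu : ∀ x, u x ∈ Set.Icc 0 b) (ξ ζ : ℝ) : |zeroExtend u ξ - zeroExtend u ζ| ≤ b := by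
  have h1 := zeroExtend_mem_Icc hb hu ξ
  have h2 := zeroExtend_mem_Icc hb hu ζ
  rw [abs_le]
  constructor <;> linarith [h1.1, h1.2, h2.1, h2.2]

theorem zeroExtend_ae_eq {u v : unitInterval → ℝ} (h : u =ᵐ[volume] v) :
    zeroExtend u =ᵐ[volume] zeroExtend v := by
  refine measure_mono_null (t := Subtype.val '' {x | u x ≠ v x}) (fun ξ hξ => ?_) ?_
  · by_cases hI : ξ ∈ Set.Icc (0 : ℝ) 1
    · refine ⟨⟨ξ, hI⟩, fun heq => hξ ?_, rfl⟩
      have h1 := zeroExtend_coe u ⟨ξ, hI⟩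
      have h2 := zeroExtend_coe v ⟨ξ, hI⟩
      exact h1.trans (heq.trans h2.symm)
    · exact absurd ((zeroExtend_of_notMem u hI).trans (zeroExtend_of_notMem v hI).symm) hξ
  · rw [← unitInterval.volume_apply]
    exact h

theorem translationModulus_congr {u v : unitInterval → ℝ} (h : u =ᵐ[volume] v) (t : ℝ) :
    translationModulus u t = translationModulus v t := by
  have h1 := zeroExtend_ae_eq h
  have h2 : ∀ᵐ ξ : ℝ, zeroExtend u (ξ + t) = zeroExtend v (ξ + t) :=
    (measurePreserving_add_right volume t).quasiMeasurePreserving.ae h1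
  refine integral_congr_ae (ae_restrict_of_ae ?_)
  filter_upwards [h1, h2] with ξ hξ1 hξ2
  rw [hξ1, hξ2]

theorem translationModulus_le_of_exceptional {u : unitInterval → ℝ}
    (hu : ∀ x, u x ∈ Set.Icc (0 : ℝ) 1) {h ε : ℝ} {B : Set ℝ}
    (hB : ∀ᵐ ξ ∂volume.restrict (Set.Icc (0 : ℝ) 1),
      ξ ∉ B → |zeroExtend u ξ - zeroExtend u (ξ + h)| ≤ ε) :
    translationModulus u h ≤ ε + (1 - ε) * (volume.restrict (Set.Icc (0 : ℝ) 1)).real B := by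
  set ν : Measure ℝ := volume.restrict (Set.Icc (0 : ℝ) 1) with hν
  have hν1 : ν.real Set.univ = 1 := by simp [hν, measureReal_def]
  set B' := toMeasurable ν B with hB'
  have hB'm : MeasurableSet B' := measurableSet_toMeasurable _ _
  have hreal : ν.real B' = ν.real B := by
    rw [measureReal_def, measureReal_def, hB', measure_toMeasurable]
  have hint : Integrable (B'.indicator fun _ => 1 - ε) ν :=
    (integrable_const (1 - ε)).indicator hB'm
  calc translationModulus u h ≤ ∫ ξ, (ε + B'.indicator (fun _ => 1 - ε) ξ) ∂ν := by
        refine integral_mono_of_nonneg (Filter.Eventually.of_forall fun ξ => abs_nonneg _)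
          ((integrable_const ε).add hint) ?_
        filter_upwards [hB] with ξ hξ
        by_cases hmem : ξ ∈ B'
        · simpa [hmem] using abs_zeroExtend_sub_le zero_le_one hu ξ (ξ + h)
        · simpa [hmem] using hξ fun hb => hmem (subset_toMeasurable ν B hb)
    _ = ε + (1 - ε) * ν.real B := by
        rw [integral_add (integrable_const ε) hint, integral_indicator hB'm]
        simp only [integral_const, hν1, smul_eq_mul, measureReal_restrict_apply_univ, hreal]
        ring

/-- The points of a relatively order-connected set which a translation by `h` moves out of it have
measure at most `|h|`. -/
theorem volume_exit_le {J D : Set ℝ}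
    (hJ : ∀ u ∈ J, ∀ v ∈ D, ∀ w ∈ J, u ≤ v → v ≤ w → v ∈ J) (h : ℝ) :
    volume {ξ | ξ ∈ J ∧ ξ + h ∈ D ∧ ξ + h ∉ J} ≤ ENNReal.ofReal |h| := by
  refine (Real.volume_le_diam _).trans (Metric.ediam_le fun ξ hξ ζ hζ => ?_)
  rw [edist_dist]
  refine ENNReal.ofReal_le_ofReal ?_
  rw [Real.dist_eq]
  by_contra! hlt
  rcases le_total ξ ζ with hle | hle <;> rcases le_total 0 h with h0 | h0
  · rw [abs_of_nonneg h0, abs_of_nonpos (by linarith)] at hlt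
    exact hξ.2.2 (hJ ξ hξ.1 _ hξ.2.1 ζ hζ.1 (by linarith) (by linarith))
  · rw [abs_of_nonpos h0, abs_of_nonpos (by linarith)] at hlt
    exact hζ.2.2 (hJ ξ hξ.1 _ hζ.2.1 ζ hζ.1 (by linarith) (by linarith))
  · rw [abs_of_nonneg h0, abs_of_nonneg (by linarith)] at hlt
    exact hζ.2.2 (hJ ζ hζ.1 _ hζ.2.1 ξ hξ.1 (by linarith) (by linarith))
  · rw [abs_of_nonpos h0, abs_of_nonneg (by linarith)] at hlt
    exact hξ.2.2 (hJ ζ hζ.1 _ hξ.2.1 ξ hξ.1 (by linarith) (by linarith))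

theorem translationModulus_le_of_cells {ι : Type*} [Fintype ι] {u : unitInterval → ℝ}
    (hu : ∀ x, u x ∈ Set.Icc (0 : ℝ) 1) {ε : ℝ} (hε : 0 ≤ ε)
    {D : Set unitInterval} (hD : volume Dᶜ = 0) {c : unitInterval → ι}
    (hc : ∀ x ∈ D, ∀ y ∈ D, ∀ z ∈ D, x ≤ y → y ≤ z → c x = c z → c y = c x)
    (hclose : ∀ x y, c x = c y → |u x - u y| ≤ ε) (h : ℝ) :
    translationModulus u h ≤ ε + Fintype.card ι * |h| := by
  set D' : Set ℝ := {ξ | ∀ hξ : ξ ∈ Set.Icc (0 : ℝ) 1, (⟨ξ, hξ⟩ : unitInterval) ∈ D} with hD'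
  have hD'ae : ∀ᵐ ξ : ℝ, ξ ∈ D' := by
    refine measure_mono_null (t := Subtype.val '' Dᶜ) (fun ξ hξ => ?_) ?_
    · have hξ' : ¬ ∀ hξ : ξ ∈ Set.Icc (0 : ℝ) 1, (⟨ξ, hξ⟩ : unitInterval) ∈ D := hξ
      push Not at hξ'
      obtain ⟨hI, hn⟩ := hξ'
      exact ⟨⟨ξ, hI⟩, hn, rfl⟩
    · rw [← unitInterval.volume_apply, hD]
  have hD'ae2 : ∀ᵐ ξ : ℝ, ξ + h ∈ D' :=
    (measurePreserving_add_right volume h).quasiMeasurePreserving.ae hD'ae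
  set J : ι → Set ℝ := fun p => Subtype.val '' {x : unitInterval | x ∈ D ∧ c x = p} with hJdef
  have hJ : ∀ p, ∀ a ∈ J p, ∀ b ∈ D', ∀ d ∈ J p, a ≤ b → b ≤ d → b ∈ J p := by
    rintro p _ ⟨x, ⟨hx, hxp⟩, rfl⟩ b hb _ ⟨z, ⟨hz, hzp⟩, rfl⟩ hab hbd
    have hI : b ∈ Set.Icc (0 : ℝ) 1 := ⟨x.2.1.trans hab, hbd.trans z.2.2⟩
    exact ⟨⟨b, hI⟩, ⟨hb hI, (hc x hx ⟨b, hI⟩ (hb hI) z hz hab hbd (hxp.trans hzp.symm)).trans hxp⟩,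
      rfl⟩
  set B : Set ℝ := ⋃ p, {ξ | ξ ∈ J p ∧ ξ + h ∈ D' ∧ ξ + h ∉ J p} with hBdef
  have hBvol : volume B ≤ ENNReal.ofReal (Fintype.card ι * |h|) := by
    refine (measure_iUnion_fintype_le _ _).trans ?_
    refine (Finset.sum_le_sum fun p _ => volume_exit_le (hJ p) h).trans ?_
    rw [Finset.sum_const, nsmul_eq_mul, ENNReal.ofReal_mul (Nat.cast_nonneg _),
      ENNReal.ofReal_natCast, Finset.card_univ]
  have hBreal : (volume.restrict (Set.Icc (0 : ℝ) 1)).real B ≤ Fintype.card ι * |h| :=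
    ENNReal.toReal_le_of_le_ofReal (by positivity) ((Measure.restrict_apply_le _ _).trans hBvol)
  have hmain : translationModulus u h ≤
      ε + (1 - ε) * (volume.restrict (Set.Icc (0 : ℝ) 1)).real B := by
    refine translationModulus_le_of_exceptional hu ?_
    filter_upwards [ae_restrict_mem measurableSet_Icc, ae_restrict_of_ae hD'ae,
      ae_restrict_of_ae hD'ae2] with ξ hI hξ hξh hnB
    set x : unitInterval := ⟨ξ, hI⟩ with hx
    have hxJ : ξ ∈ J (c x) := ⟨x, ⟨hξ hI, rfl⟩, rfl⟩
    have hmem : ξ + h ∈ J (c x) := by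
      by_contra hn
      exact hnB (Set.mem_iUnion.2 ⟨c x, hxJ, hξh, hn⟩)
    obtain ⟨y, ⟨-, hy⟩, hyξ⟩ := hmem
    rw [← hyξ, zeroExtend_coe, show ξ = (x : ℝ) from rfl, zeroExtend_coe]
    exact hclose x y hy.symm
  have hnn : 0 ≤ (volume.restrict (Set.Icc (0 : ℝ) 1)).real B := measureReal_nonneg
  nlinarith

theorem min_le_volume_inter_Iio {A D : Set unitInterval} (hD : volume Dᶜ = 0)
    (hA : ∀ x ∈ D, ∀ y ∈ D, x ≤ y → y ∈ A → x ∈ A) (t : unitInterval) :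
    min (t : ℝ) (volume.real A) ≤ volume.real (A ∩ Set.Iio t) := by
  have hae : ∀ᵐ x : unitInterval, x ∈ D := hD
  by_cases hex : ∃ x ∈ D, x < t ∧ x ∉ A
  · obtain ⟨x, hx, hxt, hxA⟩ := hex
    refine (min_le_right _ _).trans (le_of_eq (measureReal_congr ?_))
    filter_upwards [hae] with y hy
    refine propext ⟨fun hyA => ⟨hyA, ?_⟩, fun hyA => hyA.1⟩
    by_contra hty
    exact hxA (hA x hx y hy (hxt.le.trans (not_lt.1 hty)) hyA)
  · push Not at hex
    refine (min_le_left _ _).trans (le_of_eq ?_)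
    have : volume.real (A ∩ Set.Iio t) = volume.real (Set.Iio t) := by
      refine measureReal_congr ?_
      filter_upwards [hae] with y hy
      exact propext ⟨fun hyA => hyA.2, fun hyt => ⟨hex y hy hyt, hyt⟩⟩
    rw [this, measureReal_def, unitInterval.volume_Iio, ENNReal.toReal_ofReal t.2.1]

theorem min_le_volume_inter_Ioi {A D : Set unitInterval} (hD : volume Dᶜ = 0)
    (hA : ∀ x ∈ D, ∀ y ∈ D, x ≤ y → x ∈ A → y ∈ A) (t : unitInterval) :
    min (1 - t : ℝ) (volume.real A) ≤ volume.real (A ∩ Set.Ioi t) := by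
  have hae : ∀ᵐ x : unitInterval, x ∈ D := hD
  by_cases hex : ∃ x ∈ D, t < x ∧ x ∉ A
  · obtain ⟨x, hx, hxt, hxA⟩ := hex
    refine (min_le_right _ _).trans (le_of_eq (measureReal_congr ?_))
    filter_upwards [hae] with y hy
    refine propext ⟨fun hyA => ⟨hyA, ?_⟩, fun hyA => hyA.1⟩
    by_contra hty
    exact hxA (hA y hy x hx ((not_lt.1 hty).trans hxt.le) hyA)
  · push Not at hex
    refine (min_le_left _ _).trans (le_of_eq ?_)
    have : volume.real (A ∩ Set.Ioi t) = volume.real (Set.Ioi t) := by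
      refine measureReal_congr ?_
      filter_upwards [hae] with y hy
      exact propext ⟨fun hyA => hyA.2, fun hyt => ⟨hex y hy hyt, hyt⟩⟩
    rw [this, measureReal_def, unitInterval.volume_Ioi,
      ENNReal.toReal_ofReal (sub_nonneg.2 t.2.2)]

theorem translationModulus_le_one_sub {u : unitInterval → ℝ} (hu : ∀ x, u x ∈ Set.Icc (0 : ℝ) 1)
    {h : ℝ} {W : Set unitInterval} (hWm : MeasurableSet W)
    (hW : ∀ x ∈ W, |zeroExtend u x - zeroExtend u (x + h)| ≤ 1 / 2) :
    translationModulus u h ≤ 1 - volume.real W / 2 := by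
  have h1 := translationModulus_le_of_exceptional hu (h := h) (ε := 1 / 2)
    (B := (Subtype.val '' W)ᶜ) (Filter.Eventually.of_forall ?_)
  · have h2 : (volume.restrict (Set.Icc (0 : ℝ) 1)).real (Subtype.val '' W)ᶜ = volume.real Wᶜ := by
      rw [← unitInterval.measurePreserving_coe.map_eq, measureReal_def, measureReal_def,
        unitInterval.measurableEmbedding_coe.map_apply, Set.preimage_compl,
        Set.preimage_image_eq _ Subtype.val_injective]
    rw [h2, probReal_compl_eq_one_sub hWm] at h1
    linarith
  · intro ξ hξ
    rw [Set.notMem_compl_iff] at hξ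
    obtain ⟨x, hx, rfl⟩ := hξ
    exact hW x hx

/-- If `u ≤ 1/2` on an initial and on a final segment, then translations which are not too small
have modulus bounded away from `1`. -/
theorem translationModulus_le_of_ends {u : unitInterval → ℝ}
    (hu : ∀ x, u x ∈ Set.Icc (0 : ℝ) 1) {D A₁ A₂ : Set unitInterval} (hD : volume Dᶜ = 0)
    (hm₁ : MeasurableSet A₁) (hm₂ : MeasurableSet A₂)
    (h₁ : ∀ x ∈ D, ∀ y ∈ D, x ≤ y → y ∈ A₁ → x ∈ A₁)
    (h₂ : ∀ x ∈ D, ∀ y ∈ D, x ≤ y → x ∈ A₂ → y ∈ A₂)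
    (hu₁ : ∀ x ∈ A₁, u x ≤ 1 / 2) (hu₂ : ∀ x ∈ A₂, u x ≤ 1 / 2) {δ τ : ℝ}
    (hδ₁ : δ ≤ volume.real A₁) (hδ₂ : δ ≤ volume.real A₂) (hτ : 0 ≤ τ) (hτ1 : τ ≤ 1) {h : ℝ}
    (hh : τ ≤ |h|) : translationModulus u h ≤ 1 - min τ δ / 2 := by
  rcases le_total 0 h with h0 | h0
  · rw [abs_of_nonneg h0] at hh
    let t : unitInterval := ⟨1 - τ, by linarith, by linarith⟩
    have hmin := min_le_volume_inter_Ioi hD h₂ t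
    have ht : (1 - t : ℝ) = τ := sub_sub_cancel 1 τ
    rw [ht] at hmin
    have hle := translationModulus_le_one_sub hu (h := h) (hm₂.inter measurableSet_Ioi)
      (W := A₂ ∩ Set.Ioi t) fun x hx => by
        have hx2 : 1 - τ < (x : ℝ) := hx.2
        rw [zeroExtend_coe, zeroExtend_of_notMem u fun hI => by linarith [hI.2], sub_zero,
          abs_of_nonneg (hu x).1]
        exact hu₂ x hx.1
    have := min_le_min_left τ hδ₂
    linarith
  · rw [abs_of_nonpos h0] at hh
    let t : unitInterval := ⟨τ, hτ, hτ1⟩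
    have hmin := min_le_volume_inter_Iio hD h₁ t
    have hle := translationModulus_le_one_sub hu (h := h) (hm₁.inter measurableSet_Iio)
      (W := A₁ ∩ Set.Iio t) fun x hx => by
        have hx2 : (x : ℝ) < τ := hx.2
        rw [zeroExtend_coe, zeroExtend_of_notMem u fun hI => by linarith [hI.1], sub_zero,
          abs_of_nonneg (hu x).1]
        exact hu₁ x hx.1
    have := min_le_min_left τ hδ₁
    change min τ _ ≤ _ at hmin
    linarith

/-- If `u` exceeds `1/2` off a small set, then translations by at most `h₀ < 1` have modulus bounded
away from `1`. -/
theorem translationModulus_le_of_small {u : unitInterval → ℝ}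
    (hu : ∀ x, u x ∈ Set.Icc (0 : ℝ) 1) {T : Set unitInterval} (hT : ∀ x ∉ T, 1 / 2 ≤ u x) (h : ℝ) :
    translationModulus u h ≤ 1 / 2 + (|h| + 2 * volume.real T) / 2 := by
  set T' : Set ℝ := Subtype.val '' T with hT'
  have hTvol : volume T' = volume T := unitInterval.volume_apply.symm
  set B : Set ℝ := {ξ | ξ ∈ Set.Icc (0 : ℝ) 1 ∧ ξ + h ∈ Set.univ ∧ ξ + h ∉ Set.Icc (0 : ℝ) 1} ∪
    (T' ∪ (fun ξ => ξ + h) ⁻¹' T') with hB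
  have hBvol : volume B ≤ ENNReal.ofReal (|h| + 2 * volume.real T) := by
    refine (measure_union_le _ _).trans ?_
    rw [ENNReal.ofReal_add (abs_nonneg _) (by positivity), two_mul,
      ENNReal.ofReal_add (by positivity) (by positivity), ofReal_measureReal]
    refine add_le_add (volume_exit_le (J := Set.Icc (0 : ℝ) 1)
      (fun a ha b _ d hd hab hbd => ⟨ha.1.trans hab, hbd.trans hd.2⟩) h) ((measure_union_le _ _).trans ?_)
    rw [measure_preimage_add_right, hTvol]
  have hBreal : (volume.restrict (Set.Icc (0 : ℝ) 1)).real B ≤ |h| + 2 * volume.real T :=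
    ENNReal.toReal_le_of_le_ofReal (by positivity) ((Measure.restrict_apply_le _ _).trans hBvol)
  have hmain := translationModulus_le_of_exceptional hu (h := h) (ε := 1 / 2) (B := B) ?_
  · linarith
  · filter_upwards [ae_restrict_mem measurableSet_Icc] with ξ hI hnB
    have hIh : ξ + h ∈ Set.Icc (0 : ℝ) 1 := by
      by_contra hn
      exact hnB (Or.inl ⟨hI, trivial, hn⟩)
    have hx := hT ⟨ξ, hI⟩ fun hx => hnB (Or.inr (Or.inl ⟨_, hx, rfl⟩))
    have hy := hT ⟨ξ + h, hIh⟩ fun hx => hnB (Or.inr (Or.inr ⟨_, hx, rfl⟩))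
    have hx1 := (hu ⟨ξ, hI⟩).2
    have hy1 := (hu ⟨ξ + h, hIh⟩).2
    rw [show ξ = ((⟨ξ, hI⟩ : unitInterval) : ℝ) from rfl, zeroExtend_coe,
      show ((⟨ξ, hI⟩ : unitInterval) : ℝ) + h = ((⟨ξ + h, hIh⟩ : unitInterval) : ℝ) from rfl,
      zeroExtend_coe, abs_le]
    constructor <;> linarith

theorem exists_disjoint_subsets {T : Set unitInterval} (hT : MeasurableSet T) {δ : ℝ}
    (hδ : 0 ≤ δ) : ∃ S₁ S₂ : Set unitInterval, MeasurableSet S₁ ∧ MeasurableSet S₂ ∧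
      Disjoint S₁ S₂ ∧ S₁ ⊆ T ∧ S₂ ⊆ T ∧
      (2 * δ ≤ volume.real T → δ ≤ volume.real S₁ ∧ δ ≤ volume.real S₂) := by
  by_cases h : 2 * δ ≤ volume.real T
  · obtain ⟨t, ht⟩ := exists_measureReal_Iic_eq (volume.restrict T) hδ (by
      rw [measureReal_restrict_apply_univ]
      linarith)
    rw [measureReal_restrict_apply measurableSet_Iic, Set.inter_comm] at ht
    have hsplit := measureReal_inter_add_sdiff (μ := (volume : Measure unitInterval)) (s := T)
      (measurableSet_Iic (a := t))
    exact ⟨T ∩ Set.Iic t, T \ Set.Iic t, hT.inter measurableSet_Iic, hT.diff measurableSet_Iic,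
      Set.disjoint_sdiff_inter.symm, Set.inter_subset_left, Set.sdiff_subset,
      fun _ => ⟨ht.ge, by linarith⟩⟩
  · exact ⟨∅, ∅, MeasurableSet.empty, MeasurableSet.empty, disjoint_bot_left,
      Set.empty_subset _, Set.empty_subset _, fun h' => absurd h' h⟩

/-! ### The main theorem -/

theorem exists_rate_constant {η : ℝ} (hη : 0 < η) (hη1 : η < 1) :
    ∃ C : ℝ, 0 < C ∧ ∀ h M : ℝ, 0 < |h| → |h| < 1 →
      (∀ m : ℕ, M ≤ (1 / 2) ^ m + 2 ^ ((m + 1) ^ 2 + 2) * |h|) →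
      (Real.exp (-144) ≤ |h| → M ≤ 1 - η) → M ≤ (2 : ℝ) ^ (-C * √(Real.log (1 / |h|))) := by
  have hlogη : Real.logb 2 (1 - η) < 0 :=
    Real.logb_neg (by norm_num) (by linarith) (by linarith)
  refine ⟨min (1 / 6) (-Real.logb 2 (1 - η) / 12), lt_min (by norm_num) (by linarith), ?_⟩
  intro h M hh hh1 hsmall hbig
  set C := min (1 / 6) (-Real.logb 2 (1 - η) / 12) with hC
  have hC1 : C ≤ 1 / 6 := min_le_left _ _
  have hC2 : C ≤ -Real.logb 2 (1 - η) / 12 := min_le_right _ _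
  set L := Real.log (1 / |h|) with hL
  have hLh : |h| = Real.exp (-L) := by
    rw [hL, one_div, Real.log_inv, neg_neg, Real.exp_log hh]
  have hL0 : 0 < L := Real.log_pos (by rw [one_div]; exact (one_lt_inv₀ hh).2 hh1)
  set s := √L with hs
  have hs0 : 0 ≤ s := Real.sqrt_nonneg _
  have hsL : s ^ 2 = L := Real.sq_sqrt hL0.le
  rcases le_total L 144 with hle | hge
  · have hs12 : s ≤ 12 := by
      rw [hs, Real.sqrt_le_left (by norm_num)]
      linarith
    refine (hbig (by rw [hLh]; exact Real.exp_le_exp.2 (by linarith))).trans ?_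
    rw [← Real.rpow_logb (b := 2) (x := 1 - η) (by norm_num) (by norm_num) (by linarith)]
    refine Real.rpow_le_rpow_of_exponent_le one_le_two ?_
    nlinarith
  · have hs12 : 12 ≤ s := Real.le_sqrt_of_sq_le (by linarith)
    set m := ⌊s / 3⌋₊ with hm
    have hm1 : (m : ℝ) ≤ s / 3 := Nat.floor_le (by positivity)
    have hm2 : s / 3 < m + 1 := Nat.lt_floor_add_one _
    have hm3 : (3 : ℝ) < m := by linarith
    have hkey : (2 : ℝ) ^ ((m + 1) ^ 2 + 2) * |h| ≤ (1 / 2) ^ m := by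
      have h2e : (2 : ℝ) ≤ Real.exp 1 := by linarith [Real.add_one_le_exp (1 : ℝ)]
      have h1 : (2 : ℝ) ^ ((m + 1) ^ 2 + 2 + m) ≤ Real.exp L := by
        calc (2 : ℝ) ^ ((m + 1) ^ 2 + 2 + m) ≤ Real.exp 1 ^ ((m + 1) ^ 2 + 2 + m) :=
              pow_le_pow_left₀ (by norm_num) h2e _
          _ = Real.exp (((m + 1) ^ 2 + 2 + m : ℕ) : ℝ) := by rw [← Real.exp_nat_mul, mul_one]
          _ ≤ Real.exp L := by
              refine Real.exp_le_exp.2 ?_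
              push_cast
              nlinarith
      rw [hLh, Real.exp_neg, one_div, inv_pow, mul_inv_le_iff₀ (Real.exp_pos _),
        inv_mul_eq_div, le_div_iff₀ (by positivity), ← pow_add]
      exact h1
    calc M ≤ (1 / 2) ^ m + (1 / 2) ^ m := (hsmall m).trans (by linarith)
      _ = (2 : ℝ) ^ (1 - (m : ℝ)) := by
          rw [Real.rpow_sub two_pos, Real.rpow_one, Real.rpow_natCast, one_div, inv_pow,
            div_eq_mul_inv]
          ring
      _ ≤ (2 : ℝ) ^ (-C * s) := by
          refine Real.rpow_le_rpow_of_exponent_le one_le_two ?_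
          nlinarith

theorem exists_measurable_representatives {g : ℕ → unitInterval → ℝ}
    (hg : ∀ n, 1 ≤ n → MemLp (g n) ⊤ volume)
    (hb : ∀ n, 1 ≤ n → ∀ᵐ x, 0 ≤ g n x ∧ g n x ≤ (2 : ℝ) ^ (-(n : ℝ) + 1)) :
    ∃ G : ℕ → unitInterval → ℝ, (∀ n, Measurable (G n)) ∧ (∀ x, G 0 x = x) ∧
      (∀ n : ℕ, 1 ≤ n → ∀ x, G n x ∈ Set.Icc 0 ((2 : ℝ) ^ (-(n : ℝ) + 1))) ∧
      ∀ n, 1 ≤ n → g n =ᵐ[volume] G n := by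
  have hex : ∀ n : ℕ, ∃ f : unitInterval → ℝ, Measurable f ∧ (n = 0 → ∀ x, f x = x) ∧
      (1 ≤ n → (∀ x, f x ∈ Set.Icc 0 ((2 : ℝ) ^ (-(n : ℝ) + 1))) ∧ g n =ᵐ[volume] f) := by
    intro n
    rcases Nat.eq_zero_or_pos n with rfl | hn
    · exact ⟨fun x => x, measurable_subtype_coe, fun _ _ => rfl, fun h => absurd h (by norm_num)⟩
    · have hm := (hg n hn).1.aemeasurable
      have h0 : (0 : ℝ) ≤ (2 : ℝ) ^ (-(n : ℝ) + 1) := by positivity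
      refine ⟨fun x => max 0 (min ((2 : ℝ) ^ (-(n : ℝ) + 1)) (hm.mk (g n) x)),
        measurable_const.max (measurable_const.min hm.measurable_mk), fun h => by omega,
        fun _ => ⟨fun x => ⟨le_max_left _ _, max_le h0 (min_le_left _ _)⟩, ?_⟩⟩
      filter_upwards [hb n hn, hm.ae_eq_mk] with x hx hxe
      rw [← hxe, min_eq_right hx.2, max_eq_right hx.1]
  choose G hGm hG0 hG using hex
  exact ⟨G, hGm, hG0 0 rfl, fun n hn => (hG n hn).1, fun n hn => (hG n hn).2⟩

theorem two_rpow_le_half_pow {m n : ℕ} (h : m < n) :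
    (2 : ℝ) ^ (-(n : ℝ) + 1) ≤ (1 / 2) ^ m := by
  have h1 : ((1 / 2 : ℝ)) ^ m = (2 : ℝ) ^ (-(m : ℝ)) := by
    rw [Real.rpow_neg two_pos.le, Real.rpow_natCast, one_div, inv_pow]
  rw [h1]
  refine Real.rpow_le_rpow_of_exponent_le one_le_two ?_
  have : ((m : ℝ) + 1) ≤ n := by exact_mod_cast h
  linarith

theorem mainTheorem6 :
    ∀ h₀ : ℝ, 0 < h₀ → h₀ < 1 →
      ∃ C : ℝ, 0 < C ∧
        ∀ g : ℕ → unitInterval → ℝ,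
          (∀ n, 1 ≤ n → MemLp (g n) ⊤ volume) →
          (∀ n, 1 ≤ n → ∀ᵐ x, 0 ≤ g n x ∧ g n x ≤ (2 : ℝ) ^ (-(n : ℝ) + 1)) →
          ∃ Φ : unitInterval → unitInterval,
            AEInjective Φ ∧ MeasurePreserving Φ volume volume ∧
            ∀ h : ℝ, 0 < |h| → |h| ≤ h₀ →
              ∀ n, 1 ≤ n →
                translationModulus (g n ∘ Φ) h ≤ (2 : ℝ) ^ (-C * √(Real.log (1 / |h|))) := by
  intro h₀ h₀0 h₀1
  set τ : ℝ := Real.exp (-144) with hτ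
  have hτ0 : 0 < τ := Real.exp_pos _
  have hτ1 : τ ≤ 1 := Real.exp_le_one_iff.2 (by norm_num)
  set δ : ℝ := (1 - h₀) / 8 with hδ
  have hδ0 : 0 < δ := by linarith
  set η : ℝ := min τ δ / 2 with hη
  have hη0 : 0 < η := half_pos (lt_min hτ0 hδ0)
  have hηδ : η ≤ δ / 2 := by linarith [min_le_right τ δ]
  obtain ⟨C, hC0, hC⟩ := exists_rate_constant hη0 (by linarith)
  refine ⟨C, hC0, fun g hg hb => ?_⟩
  obtain ⟨G, hGm, hG0, hGb, hgG⟩ := exists_measurable_representatives hg hb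
  have hG : ∀ n x, G n x ∈ Set.Icc (0 : ℝ) 1 := by
    intro n x
    rcases Nat.eq_zero_or_pos n with rfl | hn
    · rw [hG0]
      exact x.2
    · exact ⟨(hGb n hn x).1, (hGb n hn x).2.trans
        (by simpa using two_rpow_le_half_pow (m := 0) hn)⟩
  have hTm : MeasurableSet {x | G 1 x ≤ 1 / 2} := measurableSet_le (hGm 1) measurable_const
  obtain ⟨S₁, S₂, hS₁, hS₂, hdisj, hST₁, hST₂, hS⟩ := exists_disjoint_subsets hTm hδ0.le
  obtain ⟨Φ, D, hD, hinj, hmp, hcells, hlow, hup⟩ :=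
    exists_lexicographic_rearrangement hGm hG hG0 hS₁ hS₂ hdisj
  refine ⟨Φ, ⟨D, hD, hinj⟩, hmp, fun h hh hhle n hn => ?_⟩
  have hcongr : g n ∘ Φ =ᵐ[volume] G n ∘ Φ :=
    hmp.quasiMeasurePreserving.ae_eq_comp (hgG n hn)
  rw [translationModulus_congr hcongr]
  have hu : ∀ n x, (G n ∘ Φ) x ∈ Set.Icc (0 : ℝ) 1 := fun n x => hG n _
  refine hC h _ hh (hhle.trans_lt h₀1) (fun m => ?_) fun hτh => ?_
  · obtain ⟨c, hclose, hord⟩ := hcells m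
    have := translationModulus_le_of_cells (hu n) (ε := (1 / 2) ^ m) (by positivity) hD (c := c ∘ Φ)
      (fun x hx y hy z hz => hord x hx y hy z hz) (fun x y hxy => ?_) h
    · simpa using this
    · rcases le_or_gt n m with hnm | hnm
      · exact hclose _ _ hxy n hnm
      · refine le_trans ?_ (two_rpow_le_half_pow hnm)
        exact abs_sub_le_of_nonneg_of_le (hGb n hn _).1 (hGb n hn _).2 (hGb n hn _).1
          (hGb n hn _).2
  · rcases hn.eq_or_lt with rfl | hn2
    · by_cases hT : 2 * δ ≤ volume.real {x | G 1 x ≤ 1 / 2}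
      · refine translationModulus_le_of_ends (hu 1) hD (hmp.measurable hS₁) (hmp.measurable hS₂)
          hlow hup (fun x hx => hST₁ hx) (fun x hx => hST₂ hx) ?_ ?_ hτ0.le hτ1 hτh
        · rw [hmp.measureReal_preimage hS₁.nullMeasurableSet]
          exact (hS hT).1
        · rw [hmp.measureReal_preimage hS₂.nullMeasurableSet]
          exact (hS hT).2
      · have := translationModulus_le_of_small (hu 1) (T := Φ ⁻¹' {x | G 1 x ≤ 1 / 2})
          (fun x hx => (not_le.1 hx).le) h
        rw [hmp.measureReal_preimage hTm.nullMeasurableSet] at this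
        linarith
    · have hhalf : ∀ x, (G n ∘ Φ) x ∈ Set.Icc (0 : ℝ) (1 / 2) := fun x =>
        ⟨(hu n x).1, (hGb n hn _).2.trans (by simpa using two_rpow_le_half_pow hn2)⟩
      have := translationModulus_le_of_exceptional (hu n) (h := h) (ε := 1 / 2) (B := ∅)
        (Filter.Eventually.of_forall fun ξ _ => abs_zeroExtend_sub_le (by norm_num) hhalf _ _)
      rw [measureReal_empty] at this
      linarith
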